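/- Let $n\ge 3$ and $\mathcal V=\{1,\dots,n\}$. For each $t=0,1,2,\dots$ let $\mathcal G_t=(\mathcal V,\mathcal E_t)$ be a (deterministic) directed graph without self-loops, each of whose arcs carries exactly one of the signs $+$, $-$; write $\mathcal E_t=\mathcal E_t^+\sqcup\mathcal E_t^-$. Let $E_t\subseteq\mathcal E_t$ ($t\ge0$) be independent random arc sets, put $E_t^\pm=E_t\cap\mathcal E_t^\pm$ and $N_i^{\pm}(t)=\{j:(j,i)\in E_t^{\pm}\}$. Let $(B_t)_{t\ge0}$ and $(D_t)_{t\ge0}$ be sequences of independent $\{0,1\}$-valued random variables such that the processes $(E_t)_t$, $(B_t)_t$, $(D_t)_t$ are mutually independent. For real parameters $\alpha,\beta$ and a deterministic initial state $s(0)\in\mathbb R^n$, the state-reversion model is $$s_i(t+1)=s_i(t)-\alpha B_t\sum_{j\in N_i^+(t)}\bigl(s_i(t)-s_j(t)\bigr)-\beta D_t\sum_{j\in N_i^-(t)}\bigl(s_i(t)+s_j(t)\bigr),\qquad i\in\mathcal V,\ t\ge 0.$$ Assume: (A1) there is $p_*\in(0,1)$ such that $\mathbb P((i,j)\in E_t)\ge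 p_*$ for all $t\ge 0$ and $(i,j)\in\mathcal E_t$; (A4) there is an integer $K\ge1$ such that for every $t\ge0$ the digraph $\bigl(\mathcal V,\bigcup_{\tau=t}^{t+K-1}\mathcal E_\tau^+\bigr)$ is strongly connected; (A5) there is an integer $K\ge1$ such that for every $t\ge0$ the digraph $\bigl(\mathcal V,\bigcup_{\tau=t}^{t+K-1}\mathcal E_\tau^-\bigr)$ is strongly connected; (A6) the events $\{(i,j)\in E_t\}$, $i,j\in\mathcal V$, $t\ge0$, are independent, and there is $p^*\in(0,1)$ such that $\mathbb P((i,j)\in E_t)\le p^*$ for all $t\ge0$ and $(i,j)\in\mathcal E_t$; and that $\mathbb E\{B_t\}=b$ and $\mathbb E\{D_t\}=d$ for all $t\ge0$, with constants $b,d\in(0,1)$. Fix $\alpha\in[0,(2n)^{-1}]$. Then there is $\beta_\star>0$ such that for every $\beta>\beta_\star$ and for Lebesgue-almost every initial state $s(0)\in\mathbb R^n$, $$\mathbb P\Bigl(\lim_{t\to\infty}\max_{i\in\mathcal V}|s_i(t)|=\infty\Bigr)=1.$$ -/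

import Mathlib

open MeasureTheory ProbabilityTheory Filter

namespace SignedNetwork

/-- A simple signed digraph on the node set `V`: an arc `(i, j)` is either positive or negative,
not both, and there are no self-loops. -/
structure SignedDigraph (V : Type*) where
  /-- `Pos i j`: there is a positive arc from `i` to `j`. -/
  Pos : V → V → Prop
  /-- `Neg i j`: there is a negative arc from `i` to `j`. -/
  Neg : V → V → Prop
  not_pos_and_neg : ∀ i j, ¬ (Pos i j ∧ Neg i j)
  not_pos_self : ∀ i, ¬ Pos i i
  not_neg_self : ∀ i, ¬ Neg i i

/-- `G.Arc i j`: the pair `(i, j)` is an arc (of either sign) of `G`. -/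
def SignedDigraph.Arc {V : Type*} (G : SignedDigraph V) (i j : V) : Prop :=
  G.Pos i j ∨ G.Neg i j

/-- A digraph, given by its arc relation, is strongly connected: every node is reachable from
every node by a directed path (each node being reachable from itself). -/
def StronglyConnected {V : Type*} (arc : V → V → Prop) : Prop :=
  ∀ i j, Relation.ReflTransGen arc i j

/-- The arc relation of the union of the digraphs `arc τ` over the window
`τ ∈ {t, ..., t + K - 1}` (for `K ≥ 1`). -/
def windowUnion {V : Type*} (arc : ℕ → V → V → Prop) (t K : ℕ) (i j : V) : Prop :=
  ∃ τ, t ≤ τ ∧ τ < t + K ∧ arc τ i j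

/-- The random environment on a deterministic sequence `G` of signed digraphs: the random sets
`E t` of interacting arcs, independent over time, and the sequences `B`, `D` of independent
Bernoulli attention variables; the three processes are mutually independent. -/
structure RandomEnvironment {V Ω : Type*} [MeasurableSpace Ω]
    (G : ℕ → SignedDigraph V) (P : Measure Ω) where
  /-- The random set of arcs selected at time `t`. -/
  E : ℕ → Ω → Set (V × V)
  /-- The attention paid to positive recommendations. -/
  B : ℕ → Ω → ℝ
  /-- The attention paid to negative recommendations. -/
  D : ℕ → Ω → ℝ
  measurable_E : ∀ t, Measurable (E t)
  measurable_B : ∀ t, Measurable (B t)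
  measurable_D : ∀ t, Measurable (D t)
  E_subset : ∀ t ω i j, (i, j) ∈ E t ω → (G t).Arc i j
  B_bernoulli : ∀ t ω, B t ω = 0 ∨ B t ω = 1
  D_bernoulli : ∀ t ω, D t ω = 0 ∨ D t ω = 1
  indep_E : iIndepFun E P
  indep_B : iIndepFun B P
  indep_D : iIndepFun D P
  indep_processes :
    iIndep ![⨆ t, MeasurableSpace.comap (E t) inferInstance,
      ⨆ t, MeasurableSpace.comap (B t) inferInstance,
      ⨆ t, MeasurableSpace.comap (D t) inferInstance] P

section Dynamics

variable {V Ω : Type*} [Fintype V] [MeasurableSpace Ω] {G : ℕ → SignedDigraph V} {P : Measure Ω}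

open Classical in
/-- The positive neighbours of node `i` at time `t`: the `j` for which `(j, i)` is a selected
positive arc. -/
noncomputable def posNeighbors (R : RandomEnvironment G P) (t : ℕ) (ω : Ω) (i : V) : Finset V :=
  {j | (j, i) ∈ R.E t ω ∧ (G t).Pos j i}

open Classical in
/-- The negative neighbours of node `i` at time `t`: the `j` for which `(j, i)` is a selected
negative arc. -/
noncomputable def negNeighbors (R : RandomEnvironment G P) (t : ℕ) (ω : Ω) (i : V) : Finset V :=
  {j | (j, i) ∈ R.E t ω ∧ (G t).Neg j i}

/-- The positive recommendation received by node `i` at time `t` in the network state `s`. -/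
noncomputable def posRec (R : RandomEnvironment G P) (t : ℕ) (ω : Ω) (s : V → ℝ) (i : V) : ℝ :=
  -∑ j ∈ posNeighbors R t ω i, (s i - s j)

/-- The state-reversion negative recommendation received by node `i` at time `t` in the network
state `s`. -/
noncomputable def negRec (R : RandomEnvironment G P) (t : ℕ) (ω : Ω) (s : V → ℝ) (i : V) : ℝ :=
  -∑ j ∈ negNeighbors R t ω i, (s i + s j)

/-- The network state `s(t)` of the state-reversion model with updating parameters `α`, `β` and
initial state `s₀`. -/
noncomputable def state (R : RandomEnvironment G P) (α β : ℝ) (s₀ : V → ℝ) (ω : Ω) :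
    ℕ → V → ℝ
  | 0 => s₀
  | t + 1 => fun i =>
      state R α β s₀ ω t i + α * R.B t ω * posRec R t ω (state R α β s₀ ω t) i
        + β * R.D t ω * negRec R t ω (state R α β s₀ ω t) i

end Dynamics

section Assumptions

variable {V Ω : Type*} [MeasurableSpace Ω] {G : ℕ → SignedDigraph V} {P : Measure Ω}

/-- Every arc present at time `t` is selected with probability bounded away from zero. -/
def SelectionLowerBound (R : RandomEnvironment G P) : Prop :=
  ∃ p ∈ Set.Ioo (0 : ℝ) 1, ∀ t i j, (G t).Arc i j → p ≤ P.real {ω | (i, j) ∈ R.E t ω}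

/-- The positive graphs are jointly strongly connected over all time windows of some fixed
length. -/
def PosWindowConnected (G : ℕ → SignedDigraph V) : Prop :=
  ∃ K : ℕ, 1 ≤ K ∧ ∀ t, StronglyConnected (windowUnion (fun τ => (G τ).Pos) t K)

/-- The negative graphs are jointly strongly connected over all time windows of some fixed
length. -/
def NegWindowConnected (G : ℕ → SignedDigraph V) : Prop :=
  ∃ K : ℕ, 1 ≤ K ∧ ∀ t, StronglyConnected (windowUnion (fun τ => (G τ).Neg) t K)

/-- The arc selections are independent over all arcs and times, and every arc present at time
`t` is selected with probability bounded away from one. -/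
def IndependentSelection (R : RandomEnvironment G P) : Prop :=
  iIndepSet (fun a : ℕ × V × V => {ω | (a.2.1, a.2.2) ∈ R.E a.1 ω}) P ∧
    ∃ p ∈ Set.Ioo (0 : ℝ) 1, ∀ t i j, (G t).Arc i j → P.real {ω | (i, j) ∈ R.E t ω} ≤ p

end Assumptions

end SignedNetwork

/-! The state at time `t` is a random linear image of `s₀`, and the proof shows that this flow
expands volume. Its determinant is the product of the one-step determinants. A step without an
active negative arc has `|det| ≥ c > 0` with `c` independent of `β` (`exists_forall_le_abs_det`). A
step with one has `|det| → ∞` as `β → ∞` (`tendsto_abs_det_stepMap`), so for large `β` it exceeds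
any prescribed `H`.

Joint connectivity of the negative graphs puts a negative arc in every block of `K` times. These
arcs are activated independently, each with probability at least `p * d`. For `δ` small and then `H`
large, the mean of `|det|^(-δ)` therefore decays geometrically in the number of blocks.

The initial states in a ball that are in the same ball at time `t` have volume at most a constant
times `|det|^(-δ)` (`volume_setOf_norm_le_norm_le`). The resulting bounds are summable
(`measure_prod_le_pow_div`), so Borel–Cantelli on the product of state space and `Ω`, followed by
Fubini, sends almost every trajectory out of every ball for good. -/

namespace SignedNetwork

/-! ### Determinant of one step as a function of `β` -/

section LinearAlgebra

variable {V : Type*}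

/-- The Laplacian of the digraph in which node `i` has the in-neighbours `p i`. -/
noncomputable def lapMap (p : V → Finset V) : (V → ℝ) →ₗ[ℝ] (V → ℝ) where
  toFun x i := ∑ j ∈ p i, (x i - x j)
  map_add' x y := by
    ext i
    simp only [Pi.add_apply, ← Finset.sum_add_distrib]
    exact Finset.sum_congr rfl fun j _ => by ring
  map_smul' a x := by
    ext i
    simp only [Pi.smul_apply, smul_eq_mul, Finset.mul_sum, RingHom.id_apply]
    exact Finset.sum_congr rfl fun j _ => by ring

/-- The signless Laplacian of the digraph in which node `i` has the in-neighbours `q i`. -/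
noncomputable def signlessMap (q : V → Finset V) : (V → ℝ) →ₗ[ℝ] (V → ℝ) where
  toFun x i := ∑ j ∈ q i, (x i + x j)
  map_add' x y := by
    ext i
    simp only [Pi.add_apply, ← Finset.sum_add_distrib]
    exact Finset.sum_congr rfl fun j _ => by ring
  map_smul' a x := by
    ext i
    simp only [Pi.smul_apply, smul_eq_mul, Finset.mul_sum, RingHom.id_apply]
    exact Finset.sum_congr rfl fun j _ => by ring

/-- One step of the state-reversion model, for given sets of positive and negative neighbours. -/
noncomputable def stepMap (α β : ℝ) (p q : V → Finset V) : (V → ℝ) →ₗ[ℝ] (V → ℝ) :=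
  (LinearMap.id - α • lapMap p) - β • signlessMap q

theorem signlessMap_empty : signlessMap (fun _ : V => ∅) = 0 := by
  ext x i
  simp [signlessMap]

theorem signlessMap_ne_zero {q : V → Finset V} {i : V} (h : (q i).Nonempty) :
    signlessMap q ≠ 0 := by
  intro h0
  have h1 := congrFun (LinearMap.congr_fun h0 (fun _ => (1 : ℝ))) i
  simp only [signlessMap, LinearMap.coe_mk, AddHom.coe_mk, Finset.sum_const, nsmul_eq_mul,
    LinearMap.zero_apply, Pi.zero_apply] at h1
  have h2 : (0 : ℝ) < (q i).card := by exact_mod_cast h.card_pos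
  linarith

variable [Fintype V]

/-- Row diagonal dominance of the signless Laplacian. -/
theorem norm_le_norm_add_smul_signlessMap (q : V → Finset V) {c : ℝ} (hc : 0 ≤ c) (u : V → ℝ) :
    ‖u‖ ≤ ‖u + c • signlessMap q u‖ := by
  cases isEmpty_or_nonempty V
  · simp [Subsingleton.elim u 0]
  -- At a coordinate of maximal modulus, every `u i + u j` has the sign of `u i` or vanishes.
  obtain ⟨i, hi⟩ := Finite.exists_max fun i => |u i|
  have hu : ‖u‖ ≤ |u i| := (pi_norm_le_iff_of_nonneg (abs_nonneg _)).2 fun j => hi j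
  refine hu.trans (le_trans ?_ (norm_le_pi_norm (u + c • signlessMap q u) i))
  simp only [Pi.add_apply, Pi.smul_apply, signlessMap, LinearMap.coe_mk, AddHom.coe_mk,
    smul_eq_mul, Real.norm_eq_abs]
  rcases le_total 0 (u i) with h | h
  · have h1 : 0 ≤ ∑ j ∈ q i, (u i + u j) := Finset.sum_nonneg fun j _ => by
      have := hi j
      rw [abs_of_nonneg h] at this
      linarith [neg_abs_le (u j)]
    rw [abs_of_nonneg h]
    exact le_trans (by nlinarith) (le_abs_self _)
  · have h1 : ∑ j ∈ q i, (u i + u j) ≤ 0 := Finset.sum_nonpos fun j _ => by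
      have := hi j
      rw [abs_of_nonpos h] at this
      linarith [le_abs_self (u j)]
    rw [abs_of_nonpos h]
    exact le_trans (by nlinarith) (neg_le_abs _)

/-- Diagonal dominance applied to `x + l • w` with `c = l⁻¹`: the kernel vector contributes nothing,
the factor `l` cancels, and `l → 0` gives the claim. Kernel vectors are thus Birkhoff orthogonal to
the range in the sup norm. -/
theorem norm_le_norm_add_signlessMap {q : V → Finset V} {x : V → ℝ} (hx : signlessMap q x = 0)
    (w : V → ℝ) : ‖x‖ ≤ ‖x + signlessMap q w‖ := by
  have h1 : ∀ l : ℝ, 0 < l → ‖x + l • w‖ ≤ ‖x + l • w + signlessMap q w‖ := fun l hl => by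
    have h := norm_le_norm_add_smul_signlessMap q (inv_nonneg.2 hl.le) (x + l • w)
    rwa [map_add, hx, zero_add, map_smul, smul_smul, inv_mul_cancel₀ hl.ne', one_smul] at h
  have h2 : Tendsto (fun l : ℝ => ‖x + l • w‖) (nhdsWithin 0 (Set.Ioi 0)) (nhds ‖x + (0 : ℝ) • w‖) :=
    (Continuous.tendsto (by fun_prop) 0).mono_left nhdsWithin_le_nhds
  have h3 : Tendsto (fun l : ℝ => ‖x + l • w + signlessMap q w‖) (nhdsWithin 0 (Set.Ioi 0))
      (nhds ‖x + (0 : ℝ) • w + signlessMap q w‖) :=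
    (Continuous.tendsto (by fun_prop) 0).mono_left nhdsWithin_le_nhds
  have h := le_of_tendsto_of_tendsto h2 h3 (by
    filter_upwards [self_mem_nhdsWithin] with l hl using h1 l hl)
  simpa using h

/-- Since the term `j = i` vanishes, at most `n - 1` terms of size at most `2‖x‖` remain, so `α ≤
1/(2n)` leaves the factor `1 - 1/n`. -/
theorem norm_smul_lapMap_lt {α : ℝ} (hα : α ∈ Set.Icc (0 : ℝ) (2 * (Fintype.card V : ℝ))⁻¹)
    (p : V → Finset V) {x : V → ℝ} (hx : x ≠ 0) : ‖α • lapMap p x‖ < ‖x‖ := by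
  classical
  have hx0 : 0 < ‖x‖ := norm_pos_iff.2 hx
  refine (pi_norm_lt_iff hx0).2 fun i => ?_
  have hcard : (0 : ℝ) < Fintype.card V := by exact_mod_cast Fintype.card_pos_iff.2 ⟨i⟩
  have h1 : |∑ j ∈ p i, (x i - x j)| ≤ ((Fintype.card V : ℝ) - 1) * (2 * ‖x‖) := by
    calc |∑ j ∈ p i, (x i - x j)| ≤ ∑ j ∈ p i, |x i - x j| := Finset.abs_sum_le_sum_abs _ _
      _ ≤ ∑ j, |x i - x j| :=
        Finset.sum_le_sum_of_subset_of_nonneg (Finset.subset_univ _) fun _ _ _ => abs_nonneg _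
      _ = ∑ j ∈ Finset.univ.erase i, |x i - x j| := by
        rw [← Finset.add_sum_erase _ _ (Finset.mem_univ i)]
        simp
      _ ≤ ∑ j ∈ Finset.univ.erase i, 2 * ‖x‖ := Finset.sum_le_sum fun j _ => by
        have h3 := norm_le_pi_norm x i
        have h4 := norm_le_pi_norm x j
        rw [Real.norm_eq_abs] at h3 h4
        linarith [abs_sub (x i) (x j)]
      _ = _ := by
        rw [Finset.sum_const, Finset.card_erase_of_mem (Finset.mem_univ i), nsmul_eq_mul,
          Finset.card_univ, Nat.cast_sub (Fintype.card_pos_iff.2 ⟨i⟩), Nat.cast_one]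
  simp only [Pi.smul_apply, lapMap, LinearMap.coe_mk, AddHom.coe_mk, smul_eq_mul,
    Real.norm_eq_abs, abs_mul, abs_of_nonneg hα.1]
  calc α * |∑ j ∈ p i, (x i - x j)|
      ≤ (2 * (Fintype.card V : ℝ))⁻¹ * (((Fintype.card V : ℝ) - 1) * (2 * ‖x‖)) :=
        mul_le_mul hα.2 h1 (abs_nonneg _) (by positivity)
    _ = ‖x‖ - ‖x‖ / Fintype.card V := by field_simp
    _ < ‖x‖ := by linarith [div_pos hx0 hcard]

/-- The kernel of the signless Laplacian meets the preimage of its range under `1 - α L`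
trivially. -/
theorem eq_zero_of_sub_lapMap_eq_signlessMap {α : ℝ}
    (hα : α ∈ Set.Icc (0 : ℝ) (2 * (Fintype.card V : ℝ))⁻¹) (p q : V → Finset V) {x w : V → ℝ}
    (hx : signlessMap q x = 0)
    (h : (LinearMap.id - α • lapMap p : (V → ℝ) →ₗ[ℝ] (V → ℝ)) x = signlessMap q w) : x = 0 := by
  by_contra hne
  -- Here `x - signlessMap q w = α • lapMap p x`, which is strictly shorter than `x`.
  have h1 := norm_le_norm_add_signlessMap hx (-w)
  rw [map_neg, ← h] at h1
  simp only [LinearMap.sub_apply, LinearMap.id_coe, id_eq, LinearMap.smul_apply, neg_sub,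
    add_sub_cancel] at h1
  exact absurd (norm_smul_lapMap_lt hα p hne) (not_lt.2 h1)

theorem det_sub_lapMap_ne_zero {α : ℝ}
    (hα : α ∈ Set.Icc (0 : ℝ) (2 * (Fintype.card V : ℝ))⁻¹) (p : V → Finset V) :
    LinearMap.det (LinearMap.id - α • lapMap p : (V → ℝ) →ₗ[ℝ] (V → ℝ)) ≠ 0 := by
  have h : IsUnit (LinearMap.id - α • lapMap p : (V → ℝ) →ₗ[ℝ] (V → ℝ)) := by
    rw [LinearMap.isUnit_iff_ker_eq_bot, LinearMap.ker_eq_bot']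
    intro x hx
    exact eq_zero_of_sub_lapMap_eq_signlessMap hα p (fun _ => ∅) (w := 0)
      (by simp [signlessMap_empty]) (by rw [hx, map_zero])
  exact ((LinearMap.isUnit_iff_isUnit_det _).1 h).ne_zero

/-- The determinant is the reversed characteristic polynomial evaluated at `β`. Were it constant,
the characteristic polynomial would be a power of `X`, and Cayley–Hamilton would make `N` nilpotent.
-/
theorem tendsto_abs_det_one_sub_smul [DecidableEq V] {N : Matrix V V ℝ} (hN : ¬ IsNilpotent N) :
    Tendsto (fun β : ℝ => |(1 - β • N).det|) atTop atTop := by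
  have heval : ∀ β : ℝ, (1 - β • N).det = N.charpolyRev.eval β := by
    intro β
    rw [Matrix.charpolyRev, ← Polynomial.coe_evalRingHom, RingHom.map_det]
    rw [map_sub, map_one]
    congr 2
    ext i j
    simp only [RingHom.mapMatrix_apply, Matrix.map_apply, Matrix.smul_apply, smul_eq_mul,
      Polynomial.coe_evalRingHom, Polynomial.eval_mul, Polynomial.eval_X, Polynomial.eval_C]
  simp_rw [heval]
  refine Polynomial.abs_tendsto_atTop _ ?_
  by_contra hdeg
  apply hN
  have h1 : N.charpoly.reverse.natDegree = 0 := by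
    rw [Matrix.reverse_charpoly]
    exact Polynomial.natDegree_eq_zero_iff_degree_le_zero.2 (not_lt.1 hdeg)
  rw [Polynomial.reverse_natDegree] at h1
  have h2 : N.charpoly = Polynomial.X ^ N.charpoly.natDegree := by
    ext k
    rw [Polynomial.coeff_X_pow]
    split_ifs with hk
    · rw [hk]
      exact N.charpoly_monic
    · rcases lt_or_gt_of_ne hk with h | h
      · exact Polynomial.coeff_eq_zero_of_lt_natTrailingDegree (by omega)
      · exact Polynomial.coeff_eq_zero_of_natDegree_lt h
  refine ⟨N.charpoly.natDegree, ?_⟩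
  have h3 := N.aeval_self_charpoly
  rw [h2] at h3
  simpa using h3

theorem eq_zero_of_pow_eq_zero_of_ker_range [DecidableEq V] {N : Matrix V V ℝ}
    (h : ∀ w, N.mulVec (N.mulVec w) = 0 → N.mulVec w = 0) (hN : IsNilpotent N) : N = 0 := by
  obtain ⟨k, hk⟩ := hN
  induction k with
  | zero =>
    rw [pow_zero] at hk
    rw [← mul_one N, hk, mul_zero]
  | succ k ih =>
    cases k with
    | zero => simpa using hk
    | succ k =>
      refine ih ?_
      refine Matrix.ext_of_mulVec_single fun i => ?_
      rw [pow_succ', ← Matrix.mulVec_mulVec, Matrix.zero_mulVec]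
      refine h _ ?_
      rw [Matrix.mulVec_mulVec, Matrix.mulVec_mulVec, mul_assoc, ← pow_succ' N k, ← pow_succ', hk,
        Matrix.zero_mulVec]

/-- Factor out the invertible `A = 1 - αL` to get `det A * det (1 - β A⁻¹Q)`. The kernel-range lemma
says that `A⁻¹Q` is injective on its range; if it were nilpotent it would be zero, forcing `Q = 0`.
-/
theorem tendsto_abs_det_stepMap {α : ℝ}
    (hα : α ∈ Set.Icc (0 : ℝ) (2 * (Fintype.card V : ℝ))⁻¹) (p : V → Finset V)
    {q : V → Finset V} {i : V} (hq : (q i).Nonempty) :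
    Tendsto (fun β : ℝ => |LinearMap.det (stepMap α β p q)|) atTop atTop := by
  classical
  set A : (V → ℝ) →ₗ[ℝ] (V → ℝ) := LinearMap.id - α • lapMap p with hA
  have hdet := det_sub_lapMap_ne_zero hα p
  rw [← hA] at hdet
  set a := LinearMap.toMatrix' A with ha
  set g := LinearMap.toMatrix' (signlessMap q) with hg
  have hadet : a.det = LinearMap.det A := LinearMap.det_toMatrix' A
  have hau : IsUnit a.det := by rw [hadet]; exact hdet.isUnit
  have hmul : ∀ v, a.mulVec v = A v := fun v => LinearMap.toMatrix'_mulVec A v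
  have hgmul : ∀ v, g.mulVec v = signlessMap q v := fun v => LinearMap.toMatrix'_mulVec _ v
  have hcancel : ∀ v, a.mulVec ((a⁻¹ * g).mulVec v) = g.mulVec v := fun v => by
    rw [Matrix.mulVec_mulVec, Matrix.mul_nonsing_inv_cancel_left _ _ hau]
  have hN : ¬ IsNilpotent (a⁻¹ * g) := by
    intro hnil
    have h0 : a⁻¹ * g = 0 := by
      refine eq_zero_of_pow_eq_zero_of_ker_range (fun w hw => ?_) hnil
      refine eq_zero_of_sub_lapMap_eq_signlessMap hα p q (w := w) ?_ ?_
      · rw [← hgmul, ← hcancel, hw, Matrix.mulVec_zero]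
      · rw [← hA, ← hmul, hcancel, hgmul]
    have hg0 : g = 0 := by
      rw [← Matrix.mul_nonsing_inv_cancel_left a g hau, h0, mul_zero]
    exact signlessMap_ne_zero hq ((LinearEquiv.map_eq_zero_iff LinearMap.toMatrix').1 hg0)
  have heq : ∀ β : ℝ, |LinearMap.det (stepMap α β p q)| =
      |LinearMap.det A| * |(1 - β • (a⁻¹ * g)).det| := by
    intro β
    rw [← LinearMap.det_toMatrix', ← hadet, ← abs_mul, ← Matrix.det_mul, mul_sub, mul_one,
      mul_smul_comm, Matrix.mul_nonsing_inv_cancel_left _ _ hau, ha, hg, ← map_smul, ← map_sub]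
    rfl
  simp_rw [heq]
  exact (tendsto_abs_det_one_sub_smul hN).const_mul_atTop (abs_pos.2 hdet)

theorem exists_forall_le_abs_det {α : ℝ}
    (hα : α ∈ Set.Icc (0 : ℝ) (2 * (Fintype.card V : ℝ))⁻¹) :
    ∃ c ∈ Set.Ioc (0 : ℝ) 1, ∀ (β : ℝ) (p : V → Finset V),
      c ≤ |LinearMap.det (stepMap α β p fun _ => ∅)| := by
  classical
  have h : ∀ (β : ℝ) (p : V → Finset V), stepMap α β p (fun _ => ∅) =
      LinearMap.id - α • lapMap p := fun β p => by
    simp [stepMap, signlessMap_empty]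
  simp_rw [h]
  obtain ⟨p₀, hp₀⟩ := Finite.exists_min fun p : V → Finset V =>
    |LinearMap.det (LinearMap.id - α • lapMap p : (V → ℝ) →ₗ[ℝ] (V → ℝ))|
  exact ⟨min 1 _, ⟨lt_min one_pos (abs_pos.2 (det_sub_lapMap_ne_zero hα p₀)), min_le_left _ _⟩,
    fun _ p => (min_le_right _ _).trans (hp₀ p)⟩

theorem eventually_le_abs_det {α : ℝ}
    (hα : α ∈ Set.Icc (0 : ℝ) (2 * (Fintype.card V : ℝ))⁻¹) (H : ℝ) :
    ∀ᶠ β : ℝ in atTop, ∀ (p q : V → Finset V), (∃ i, (q i).Nonempty) →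
      H ≤ |LinearMap.det (stepMap α β p q)| := by
  refine eventually_all.2 fun p => eventually_all.2 fun q => eventually_imp_distrib_left.2 ?_
  rintro ⟨i, hi⟩
  exact (tendsto_abs_det_stepMap hα p hi).eventually_ge_atTop H

end LinearAlgebra

/-! ### Block products, volume and moment estimates -/

section Estimates

/-- The order of choice matters: `δ → 0` brings the second term below `1`, and only then does `H →
∞` remove the first. -/
theorem exists_rpow_neg_add_lt_one {γ q : ℝ} (hγ : 0 < γ) (hq : 0 < q) :
    ∃ δ ∈ Set.Ioc (0 : ℝ) 1, ∃ H : ℝ, 1 ≤ H ∧ (γ * H) ^ (-δ) + γ ^ (-δ) * (1 - q) < 1 := by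
  have h1 : Tendsto (fun δ : ℝ => γ ^ (-δ) * (1 - q)) (nhdsWithin 0 (Set.Ioi 0))
      (nhds (γ ^ (-(0 : ℝ)) * (1 - q))) := by
    refine (Continuous.tendsto ?_ 0).mono_left nhdsWithin_le_nhds
    exact ((Real.continuous_const_rpow hγ.ne').comp continuous_neg).mul_const _
  rw [neg_zero, Real.rpow_zero, one_mul] at h1
  obtain ⟨δ, hδ1, hδ2⟩ := ((h1.eventually_lt_const (by linarith : 1 - q < 1)).and
    (Ioc_mem_nhdsGT one_pos)).exists
  have h2 : Tendsto (fun H : ℝ => (γ * H) ^ (-δ)) atTop (nhds 0) :=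
    (tendsto_rpow_neg_atTop hδ2.1).comp (tendsto_id.const_mul_atTop hγ)
  obtain ⟨H, hH1, hH2⟩ := ((h2.eventually_lt_const (sub_pos.2 hδ1)).and
    (eventually_ge_atTop 1)).exists
  exact ⟨δ, hδ2, H, hH2, by linarith⟩

theorem prod_block_le_prod_range {a : ℕ → ℝ} {c H : ℝ} (hc : c ∈ Set.Ioc (0 : ℝ) 1)
    (ha : ∀ s, c ≤ a s) (K : ℕ) {τ : ℕ → ℕ} (hτ : ∀ k, k * K ≤ τ k ∧ τ k < k * K + K)
    {u : ℕ → Prop} [DecidablePred u] (hH : 0 ≤ H) (hu : ∀ k, u k → H ≤ a (τ k)) (m : ℕ) :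
    ∏ k ∈ Finset.range m, (c ^ K * if u k then H else 1) ≤ ∏ s ∈ Finset.range (m * K), a s := by
  have hblock : ∀ k, (c ^ K * if u k then H else 1) ≤ ∏ x ∈ Finset.range K, a (k * K + x) := by
    intro k
    split_ifs with h
    · obtain ⟨x, hx⟩ := Nat.exists_eq_add_of_le (hτ k).1
      have hxK : x < K := by have := (hτ k).2; omega
      rw [← Finset.mul_prod_erase _ _ (Finset.mem_range.2 hxK), ← hx, mul_comm]
      refine mul_le_mul (hu k h) ?_ (pow_nonneg hc.1.le _) (hH.trans (hu k h))
      -- Only `K - 1` factors remain beside the active one; as `c ≤ 1`, a spare `c` keeps both cases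
      -- uniform.
      calc c ^ K ≤ c ^ (K - 1) := pow_le_pow_of_le_one hc.1.le hc.2 (Nat.sub_le _ _)
        _ = ∏ _y ∈ (Finset.range K).erase x, c := by
          rw [Finset.prod_const, Finset.card_erase_of_mem (Finset.mem_range.2 hxK),
            Finset.card_range]
        _ ≤ _ := Finset.prod_le_prod (fun _ _ => hc.1.le) fun _ _ => ha _
    · rw [mul_one]
      calc c ^ K = ∏ _y ∈ Finset.range K, c := by rw [Finset.prod_const, Finset.card_range]
        _ ≤ _ := Finset.prod_le_prod (fun _ _ => hc.1.le) fun _ _ => ha _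
  induction m with
  | zero => simp
  | succ m ih =>
    rw [Finset.prod_range_succ, Nat.succ_mul, Finset.prod_range_add]
    refine mul_le_mul ih (hblock m) ?_ (Finset.prod_nonneg fun s _ => hc.1.le.trans (ha s))
    have := hc.1
    split_ifs <;> positivity

theorem pow_mul_prod_block_le_prod_range {a : ℕ → ℝ} {c H : ℝ} (hc : c ∈ Set.Ioc (0 : ℝ) 1)
    (ha : ∀ s, c ≤ a s) {K : ℕ} (hK : 1 ≤ K) {τ : ℕ → ℕ}
    (hτ : ∀ k, k * K ≤ τ k ∧ τ k < k * K + K) {u : ℕ → Prop} [DecidablePred u] (hH : 0 ≤ H)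
    (hu : ∀ k, u k → H ≤ a (τ k)) (t : ℕ) :
    c ^ K * ∏ k ∈ Finset.range (t / K), (c ^ K * if u k then H else 1) ≤
      ∏ s ∈ Finset.range t, a s := by
  have ht : t = t / K * K + t % K := (Nat.div_add_mod' t K).symm
  conv_rhs => rw [ht, Finset.prod_range_add, mul_comm]
  refine mul_le_mul ?_ (prod_block_le_prod_range hc ha K hτ hH hu _) ?_
    (Finset.prod_nonneg fun s _ => hc.1.le.trans (ha _))
  · calc c ^ K ≤ c ^ (t % K) := pow_le_pow_of_le_one hc.1.le hc.2 (Nat.mod_lt _ hK).le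
      _ = ∏ _y ∈ Finset.range (t % K), c := by rw [Finset.prod_const, Finset.card_range]
      _ ≤ _ := Finset.prod_le_prod (fun _ _ => hc.1.le) fun _ _ => ha _
  · have := hc.1
    refine Finset.prod_nonneg fun k _ => ?_
    split_ifs <;> positivity

/-- The two constraints give the factors `1` and `|det f|⁻¹`; their minimum is at most `|det f| ^
(-δ)` because `0 < δ ≤ 1`. -/
theorem volume_setOf_norm_le_norm_le {V : Type*} [Fintype V] (f : (V → ℝ) →ₗ[ℝ] (V → ℝ))
    (hf : LinearMap.det f ≠ 0) {δ : ℝ} (hδ : δ ∈ Set.Ioc (0 : ℝ) 1) (N : ℝ) :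
    volume {x : V → ℝ | ‖x‖ ≤ N ∧ ‖f x‖ ≤ N} ≤
      volume (Metric.closedBall (0 : V → ℝ) N) * ENNReal.ofReal (|LinearMap.det f| ^ (-δ)) := by
  have h0 : 0 < |LinearMap.det f| := abs_pos.2 hf
  rcases le_total |LinearMap.det f| 1 with h | h
  · calc volume {x : V → ℝ | ‖x‖ ≤ N ∧ ‖f x‖ ≤ N}
        ≤ volume (Metric.closedBall (0 : V → ℝ) N) * 1 := by
          rw [mul_one]
          exact measure_mono fun x hx => mem_closedBall_zero_iff.2 hx.1
      _ ≤ _ := by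
          gcongr
          rw [ENNReal.one_le_ofReal]
          exact Real.one_le_rpow_of_pos_of_le_one_of_nonpos h0 h (neg_nonpos.2 hδ.1.le)
  · calc volume {x : V → ℝ | ‖x‖ ≤ N ∧ ‖f x‖ ≤ N}
        ≤ volume (f ⁻¹' Metric.closedBall (0 : V → ℝ) N) :=
          measure_mono fun x hx => mem_closedBall_zero_iff.2 hx.2
      _ = volume (Metric.closedBall (0 : V → ℝ) N) * ENNReal.ofReal |(LinearMap.det f)⁻¹| := by
          rw [Measure.addHaar_preimage_linearMap _ hf, mul_comm]
      _ ≤ _ := by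
          gcongr
          rw [abs_inv, ← Real.rpow_neg_one]
          exact Real.rpow_le_rpow_of_exponent_le h (by linarith [hδ.2])

theorem lintegral_prod_add_mul_one_sub_indicator_le {Ω : Type*} [MeasurableSpace Ω]
    {P : Measure Ω} [IsProbabilityMeasure P] {U : ℕ → Set Ω} (hU : ∀ k, MeasurableSet (U k))
    (hind : iIndepSet U P) {q : ENNReal} (hq : ∀ k, q ≤ P (U k)) (A B : ENNReal) (m : ℕ) :
    ∫⁻ ω, ∏ k ∈ Finset.range m, (A + B * (1 - (U k).indicator (fun _ => 1) ω)) ∂P ≤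
      (A + B * (1 - q)) ^ m := by
  have hmeas : ∀ k, Measurable ((U k).indicator fun _ => (1 : ENNReal)) := fun k =>
    measurable_const.indicator (hU k)
  have hg : Measurable fun x : ENNReal => A + B * (1 - x) := by fun_prop
  have hI := (hind.iIndepFun_indicator (β := ENNReal)).comp (fun _ x => A + B * (1 - x))
    fun _ => hg
  have h := lintegral_prod_eq_prod_lintegral_of_indepFun (Finset.range m) _ hI
    fun k => hg.comp (hmeas k)
  simp only [Function.comp_apply] at h
  rw [h, ← Finset.card_range m, ← Finset.prod_const, Finset.card_range]
  refine Finset.prod_le_prod' fun k _ => ?_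
  have hsub : ∫⁻ ω, (1 - (U k).indicator (fun _ => 1) ω) ∂P = 1 - P (U k) := by
    rw [lintegral_sub (hmeas k), lintegral_indicator_const (hU k)]
    · simp
    · rw [lintegral_indicator_const (hU k)]
      simp
    · exact Eventually.of_forall fun ω => Set.indicator_le_self' (fun _ _ => zero_le) ω
  rw [lintegral_add_left measurable_const, lintegral_const_mul _ (by fun_prop), hsub]
  simp only [lintegral_const, measure_univ, mul_one]
  gcongr
  exact hq k

theorem tsum_pow_div_ne_top {ρ : ENNReal} (hρ : ρ < 1) {K : ℕ} (hK : 1 ≤ K) :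
    ∑' t : ℕ, ρ ^ (t / K) ≠ ⊤ := by
  have : NeZero K := ⟨by omega⟩
  have h := (Nat.divModEquiv K).tsum_eq fun x : ℕ × Fin K => ρ ^ x.1
  simp only [Nat.divModEquiv_apply] at h
  rw [h, ENNReal.tsum_prod (f := fun k _ => ρ ^ k)]
  simp only [tsum_fintype, Finset.sum_const, nsmul_eq_mul]
  rw [ENNReal.tsum_mul_left, ENNReal.tsum_geometric]
  exact ENNReal.mul_ne_top (by simp) (ENNReal.inv_ne_top.2 (tsub_pos_of_lt hρ).ne')

end Estimates

section Arcs

variable {V Ω : Type*} [MeasurableSpace Ω] {G : ℕ → SignedDigraph V} {P : Measure Ω}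

theorem measurableSet_mem_E (R : RandomEnvironment G P) (t : ℕ) (a : V × V) :
    MeasurableSet {ω | a ∈ R.E t ω} :=
  R.measurable_E t (measurableSet_setOfPred.2 (measurable_set_mem a))

end Arcs

/-! ### The flow as a product of random linear maps -/

section StateMap

variable {V Ω : Type*} [Fintype V] [MeasurableSpace Ω] {G : ℕ → SignedDigraph V} {P : Measure Ω}

open Classical in
/-- The random linear map by which the state evolves from time `t` to time `t + 1`. -/
noncomputable def randomStep (R : RandomEnvironment G P) (α β : ℝ) (ω : Ω) (t : ℕ) :
    (V → ℝ) →ₗ[ℝ] (V → ℝ) :=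
  stepMap α β (if R.B t ω = 1 then posNeighbors R t ω else fun _ => ∅)
    (if R.D t ω = 1 then negNeighbors R t ω else fun _ => ∅)

/-- The random linear map that sends the initial state to the state at time `t`. -/
noncomputable def stateMap (R : RandomEnvironment G P) (α β : ℝ) (ω : Ω) :
    ℕ → (V → ℝ) →ₗ[ℝ] (V → ℝ)
  | 0 => LinearMap.id
  | t + 1 => randomStep R α β ω t ∘ₗ stateMap R α β ω t

theorem randomStep_apply (R : RandomEnvironment G P) (α β : ℝ) (ω : Ω) (t : ℕ) (s : V → ℝ)
    (i : V) : randomStep R α β ω t s i =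
      s i + α * R.B t ω * posRec R t ω s i + β * R.D t ω * negRec R t ω s i := by
  rcases R.B_bernoulli t ω with hB | hB <;> rcases R.D_bernoulli t ω with hD | hD <;>
    simp [randomStep, stepMap, hB, hD, posRec, negRec, lapMap,
      signlessMap] <;> ring

theorem state_eq_stateMap (R : RandomEnvironment G P) (α β : ℝ) (s₀ : V → ℝ) (ω : Ω) (t : ℕ) :
    state R α β s₀ ω t = stateMap R α β ω t s₀ := by
  induction t with
  | zero => rfl
  | succ t ih =>
    ext i
    rw [state, stateMap, LinearMap.comp_apply, randomStep_apply, ih]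

theorem abs_det_stateMap (R : RandomEnvironment G P) (α β : ℝ) (ω : Ω) (t : ℕ) :
    |LinearMap.det (stateMap R α β ω t)| =
      ∏ s ∈ Finset.range t, |LinearMap.det (randomStep R α β ω s)| := by
  induction t with
  | zero => simp [stateMap]
  | succ t ih => rw [stateMap, LinearMap.det_comp, abs_mul, ih, Finset.prod_range_succ, mul_comm]

theorem measurable_state (R : RandomEnvironment G P) (α β : ℝ) (t : ℕ) :
    Measurable fun z : (V → ℝ) × Ω => state R α β z.1 z.2 t := by
  classical
  induction t with
  | zero => exact measurable_fst
  | succ t ih =>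
    have hs : ∀ i, Measurable fun z : (V → ℝ) × Ω => state R α β z.1 z.2 t i := fun i =>
      (measurable_pi_apply i).comp ih
    have hE : ∀ (a : V × V) (r : Prop), MeasurableSet {z : (V → ℝ) × Ω | a ∈ R.E t z.2 ∧ r} :=
      fun a r => (measurable_snd (measurableSet_mem_E R t a)).inter (MeasurableSet.const r)
    have hB := (R.measurable_B t).comp (measurable_snd : Measurable fun z : (V → ℝ) × Ω => z.2)
    have hD := (R.measurable_D t).comp (measurable_snd : Measurable fun z : (V → ℝ) × Ω => z.2)
    refine measurable_pi_iff.2 fun i => ?_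
    simp only [state, posRec, negRec, posNeighbors, negNeighbors, Finset.sum_filter]
    refine ((hs i).add ((hB.const_mul α).mul ?_)).add ((hD.const_mul β).mul ?_)
    · exact (Finset.measurable_sum _ fun j _ =>
        Measurable.ite (hE _ _) ((hs i).sub (hs j)) measurable_const).neg
    · exact (Finset.measurable_sum _ fun j _ =>
        Measurable.ite (hE _ _) ((hs i).add (hs j)) measurable_const).neg

end StateMap

/-! ### Independent activation of negative arcs -/

section Activation

variable {V Ω : Type*} [MeasurableSpace Ω] {G : ℕ → SignedDigraph V} {P : Measure Ω}

theorem exists_neg_arc_of_windowConnected [Nontrivial V] {K t : ℕ}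
    (h : StronglyConnected (windowUnion (fun τ => (G τ).Neg) t K)) :
    ∃ (τ : ℕ) (a : V × V), (t ≤ τ ∧ τ < t + K) ∧ (G τ).Neg a.1 a.2 := by
  obtain ⟨i, j, hij⟩ := exists_pair_ne V
  rcases (h i j).cases_head with h0 | ⟨k, ⟨τ, h1, h2, h3⟩, -⟩
  · exact absurd h0 hij
  · exact ⟨τ, (i, k), ⟨h1, h2⟩, h3⟩

/-- The event that the arc `a` is selected at time `t` and negative recommendations are attended
to at that time. -/
def activation (R : RandomEnvironment G P) (t : ℕ) (a : V × V) : Set Ω :=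
  {ω | a ∈ R.E t ω} ∩ {ω | R.D t ω = 1}

theorem measurableSet_comap_mem_E (R : RandomEnvironment G P) (t : ℕ) (a : V × V) :
    MeasurableSet[MeasurableSpace.comap (R.E t) inferInstance] {ω | a ∈ R.E t ω} :=
  ⟨{s | a ∈ s}, measurableSet_setOfPred.2 (measurable_set_mem a), rfl⟩

theorem measurableSet_comap_D_eq_one (R : RandomEnvironment G P) (t : ℕ) :
    MeasurableSet[MeasurableSpace.comap (R.D t) inferInstance] {ω | R.D t ω = 1} :=
  ⟨{1}, measurableSet_singleton 1, rfl⟩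

theorem measurableSet_D_eq_one (R : RandomEnvironment G P) (t : ℕ) :
    MeasurableSet {ω | R.D t ω = 1} :=
  R.measurable_D t (measurableSet_singleton 1)

theorem indep_E_D (R : RandomEnvironment G P) :
    Indep (⨆ t, MeasurableSpace.comap (R.E t) inferInstance)
      (⨆ t, MeasurableSpace.comap (R.D t) inferInstance) P :=
  R.indep_processes.indep (i := 0) (j := 2) (by decide)

theorem measure_activation (R : RandomEnvironment G P) (t : ℕ) (a : V × V) :
    P (activation R t a) = P {ω | a ∈ R.E t ω} * P {ω | R.D t ω = 1} :=
  (Indep_iff _ _ _).1 (indep_E_D R) _ _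
    (le_iSup (fun t => MeasurableSpace.comap (R.E t) inferInstance) t _
      (measurableSet_comap_mem_E R t a))
    (le_iSup (fun t => MeasurableSpace.comap (R.D t) inferInstance) t _
      (measurableSet_comap_D_eq_one R t))

theorem measurableSet_activation (R : RandomEnvironment G P) (t : ℕ) (a : V × V) :
    MeasurableSet (activation R t a) :=
  (measurableSet_mem_E R t a).inter (measurableSet_D_eq_one R t)

/-- Distinct times give independence within `E` and within `D`; independence of the two processes
from each other combines them. -/
theorem iIndepSet_activation (R : RandomEnvironment G P) {τ : ℕ → ℕ}
    (hτ : Function.Injective τ) (a : ℕ → V × V) :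
    iIndepSet (fun k => activation R (τ k) (a k)) P := by
  refine (iIndepSet_iff_meas_biInter fun k => measurableSet_activation R _ _).2 fun S => ?_
  have hE := (R.indep_E.precomp hτ).meas_biInter (S := S)
    fun k _ => measurableSet_comap_mem_E R (τ k) (a k)
  have hD := (R.indep_D.precomp hτ).meas_biInter (S := S)
    fun k _ => measurableSet_comap_D_eq_one R (τ k)
  have hsplit : ⋂ k ∈ S, activation R (τ k) (a k) =
      (⋂ k ∈ S, {ω | a k ∈ R.E (τ k) ω}) ∩ ⋂ k ∈ S, {ω | R.D (τ k) ω = 1} := by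
    simp only [activation, Set.iInter_inter_distrib]
  simp_rw [measure_activation, Finset.prod_mul_distrib, hsplit]
  rw [← hE, ← hD]
  exact (Indep_iff _ _ _).1 (indep_E_D R) _ _
    (Finset.measurableSet_biInter _ fun k _ =>
      le_iSup (fun t => MeasurableSpace.comap (R.E t) inferInstance) (τ k) _
        (measurableSet_comap_mem_E R (τ k) (a k)))
    (Finset.measurableSet_biInter _ fun k _ =>
      le_iSup (fun t => MeasurableSpace.comap (R.D t) inferInstance) (τ k) _
        (measurableSet_comap_D_eq_one R (τ k)))

theorem measureReal_D_eq_one (R : RandomEnvironment G P) (t : ℕ) :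
    P.real {ω | R.D t ω = 1} = ∫ ω, R.D t ω ∂P := by
  rw [← integral_indicator_one (measurableSet_D_eq_one R t)]
  congr 1
  ext ω
  rcases R.D_bernoulli t ω with h | h <;> simp [h, Set.indicator]

end Activation

/-! ### Volume expansion and Borel–Cantelli -/

section Growth

variable {V Ω : Type*} [Fintype V] [MeasurableSpace Ω] {G : ℕ → SignedDigraph V} {P : Measure Ω}

theorem le_abs_det_randomStep (R : RandomEnvironment G P) {α β c : ℝ}
    (hempty : ∀ p : V → Finset V, c ≤ |LinearMap.det (stepMap α β p fun _ => ∅)|)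
    (hne : ∀ p q : V → Finset V, (∃ i, (q i).Nonempty) → c ≤ |LinearMap.det (stepMap α β p q)|)
    (ω : Ω) (t : ℕ) : c ≤ |LinearMap.det (randomStep R α β ω t)| := by
  classical
  have h : ∀ p q : V → Finset V, c ≤ |LinearMap.det (stepMap α β p q)| := by
    intro p q
    by_cases hq : ∃ i, (q i).Nonempty
    · exact hne p q hq
    · have hq0 : q = fun _ => ∅ :=
        funext fun i => Finset.not_nonempty_iff_eq_empty.1 (not_exists.1 hq i)
      rw [hq0]
      exact hempty p
  exact h _ _

theorem le_abs_det_randomStep_of_activation (R : RandomEnvironment G P) {α β H : ℝ}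
    (hne : ∀ p q : V → Finset V, (∃ i, (q i).Nonempty) → H ≤ |LinearMap.det (stepMap α β p q)|)
    {ω : Ω} {t : ℕ} {a : V × V} (ha : (G t).Neg a.1 a.2) (hω : ω ∈ activation R t a) :
    H ≤ |LinearMap.det (randomStep R α β ω t)| := by
  classical
  have hD : R.D t ω = 1 := hω.2
  refine hne _ _ ⟨a.2, a.1, ?_⟩
  rw [if_pos hD, negNeighbors, Finset.mem_filter]
  exact ⟨Finset.mem_univ _, hω.1, ha⟩

theorem ae_ae_tendsto_of_tsum_ne_top [IsProbabilityMeasure P] (R : RandomEnvironment G P)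
    {α β : ℝ} (h : ∀ N : ℕ, ∑' t, ((volume : Measure (V → ℝ)).prod P)
      {z | ‖z.1‖ ≤ N ∧ ‖state R α β z.1 z.2 t‖ ≤ N} ≠ ⊤) :
    ∀ᵐ s₀ : V → ℝ ∂volume, ∀ᵐ ω ∂P,
      Tendsto (fun t : ℕ => ⨆ i, |state R α β s₀ ω t i|) atTop atTop := by
  have h1 := ae_all_iff.2 fun N => ae_eventually_notMem (h N)
  refine (Measure.ae_ae_of_ae_prod h1).mono fun s₀ hs => hs.mono fun ω hω => ?_
  refine tendsto_atTop.2 fun C => ?_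
  -- With `N ≥ ‖s₀‖` the first constraint always holds, so eventual avoidance concerns the state at
  -- time `t` alone.
  obtain ⟨N, hN⟩ := exists_nat_ge (max ‖s₀‖ C)
  filter_upwards [hω N] with t ht
  by_contra hC
  refine ht ⟨(le_max_left _ _).trans hN, ?_⟩
  refine (pi_norm_le_iff_of_nonneg (Nat.cast_nonneg N)).2 fun i => ?_
  calc ‖state R α β s₀ ω t i‖ ≤ ⨆ i, |state R α β s₀ ω t i| :=
        le_ciSup (f := fun i => |state R α β s₀ ω t i|) (Set.finite_range _).bddAbove i
    _ ≤ N := (not_le.1 hC).le.trans ((le_max_right _ _).trans hN)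

/-- The determinant of the flow grows exponentially in mean, so that the flow expands volume. -/
theorem measure_prod_le_pow_div [IsProbabilityMeasure P] (R : RandomEnvironment G P)
    {α β c H δ : ℝ} {q : ENNReal} {K : ℕ} {τ : ℕ → ℕ} {a : ℕ → V × V}
    (hc : c ∈ Set.Ioc (0 : ℝ) 1) (hH : 1 ≤ H) (hδ : δ ∈ Set.Ioc (0 : ℝ) 1) (hK : 1 ≤ K)
    (hτ : ∀ k, k * K ≤ τ k ∧ τ k < k * K + K) (ha : ∀ k, (G (τ k)).Neg (a k).1 (a k).2)
    (hq : ∀ k, q ≤ P (activation R (τ k) (a k)))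
    (hempty : ∀ p : V → Finset V, c ≤ |LinearMap.det (stepMap α β p fun _ => ∅)|)
    (hne : ∀ p q : V → Finset V, (∃ i, (q i).Nonempty) → H ≤ |LinearMap.det (stepMap α β p q)|)
    (N : ℝ) (t : ℕ) :
    ((volume : Measure (V → ℝ)).prod P) {z | ‖z.1‖ ≤ N ∧ ‖state R α β z.1 z.2 t‖ ≤ N} ≤
      volume (Metric.closedBall (0 : V → ℝ) N) * ENNReal.ofReal ((c ^ K) ^ (-δ)) *
        (ENNReal.ofReal ((c ^ K * H) ^ (-δ)) + ENNReal.ofReal ((c ^ K) ^ (-δ)) * (1 - q)) ^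
          (t / K) := by
  classical
  have hcK : 0 < c ^ K := pow_pos hc.1 K
  have hH0 : 0 < H := one_pos.trans_le hH
  have hτinj : Function.Injective τ := by
    refine (strictMono_nat_of_lt_succ fun k => ?_).injective
    have h1 := (hτ k).2
    have h2 := (hτ (k + 1)).1
    rw [Nat.succ_mul] at h2
    omega
  set A := ENNReal.ofReal ((c ^ K * H) ^ (-δ))
  set B := ENNReal.ofReal ((c ^ K) ^ (-δ)) with hB
  set U := fun k => activation R (τ k) (a k) with hU
  have hdet : ∀ ω s, c ≤ |LinearMap.det (randomStep R α β ω s)| :=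
    le_abs_det_randomStep R hempty fun p q h => (hc.2.trans hH).trans (hne p q h)
  have hpt : ∀ ω, ENNReal.ofReal (|LinearMap.det (stateMap R α β ω t)| ^ (-δ)) ≤
      B * ∏ k ∈ Finset.range (t / K), (A + B * (1 - (U k).indicator (fun _ => 1) ω)) := by
    intro ω
    have h := pow_mul_prod_block_le_prod_range hc (hdet ω) hK hτ (u := fun k => ω ∈ U k) hH0.le
      (fun k hk => le_abs_det_randomStep_of_activation R hne (ha k) hk) t
    rw [← abs_det_stateMap] at h
    have hfac : ∀ k, 0 < c ^ K * if ω ∈ U k then H else 1 := fun k => by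
      split_ifs <;> positivity
    have hprod : 0 < ∏ k ∈ Finset.range (t / K), (c ^ K * if ω ∈ U k then H else 1) :=
      Finset.prod_pos fun k _ => hfac k
    calc ENNReal.ofReal (|LinearMap.det (stateMap R α β ω t)| ^ (-δ))
        ≤ ENNReal.ofReal ((c ^ K * ∏ k ∈ Finset.range (t / K),
            (c ^ K * if ω ∈ U k then H else 1)) ^ (-δ)) :=
          ENNReal.ofReal_le_ofReal
            (Real.rpow_le_rpow_of_nonpos (mul_pos hcK hprod) h (neg_nonpos.2 hδ.1.le))
      _ = B * ∏ k ∈ Finset.range (t / K),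
            ENNReal.ofReal ((c ^ K * if ω ∈ U k then H else 1) ^ (-δ)) := by
          rw [Real.mul_rpow hcK.le hprod.le, ENNReal.ofReal_mul (by positivity),
            ← Real.finsetProd_rpow _ _ fun k _ => (hfac k).le,
            ENNReal.ofReal_prod_of_nonneg fun k _ => Real.rpow_nonneg (hfac k).le _]
      _ ≤ _ := by
          gcongr with k
          -- An activated block gives exactly `A`; any other gives `B ≤ A + B`.
          by_cases hk : ω ∈ U k <;> simp [hk, A, hB]
  have hmeas : MeasurableSet {z : (V → ℝ) × Ω | ‖z.1‖ ≤ N ∧ ‖state R α β z.1 z.2 t‖ ≤ N} :=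
    (measurableSet_le measurable_fst.norm measurable_const).inter
      (measurableSet_le (measurable_state R α β t).norm measurable_const)
  rw [Measure.prod_apply_symm hmeas]
  calc ∫⁻ ω, volume ((fun s₀ => (s₀, ω)) ⁻¹'
        {z : (V → ℝ) × Ω | ‖z.1‖ ≤ N ∧ ‖state R α β z.1 z.2 t‖ ≤ N}) ∂P
      ≤ ∫⁻ ω, volume (Metric.closedBall (0 : V → ℝ) N) * (B * ∏ k ∈ Finset.range (t / K),
          (A + B * (1 - (U k).indicator (fun _ => 1) ω))) ∂P := by
        refine lintegral_mono fun ω => ?_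
        have hne0 : LinearMap.det (stateMap R α β ω t) ≠ 0 := by
          rw [← abs_pos, abs_det_stateMap]
          exact Finset.prod_pos fun s _ => hc.1.trans_le (hdet ω s)
        refine le_trans ?_ (mul_le_mul_right (hpt ω) _)
        simp only [Set.preimage_ofPred_eq, state_eq_stateMap]
        exact volume_setOf_norm_le_norm_le _ hne0 hδ N
    _ = volume (Metric.closedBall (0 : V → ℝ) N) * B * ∫⁻ ω, ∏ k ∈ Finset.range (t / K),
          (A + B * (1 - (U k).indicator (fun _ => 1) ω)) ∂P := by
        simp_rw [← mul_assoc]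
        refine lintegral_const_mul _ (Finset.measurable_prod _ fun k _ => ?_)
        exact ((measurable_const.sub (measurable_const.indicator
          (measurableSet_activation R _ _))).const_mul B).const_add A
    _ ≤ _ := by
        gcongr
        exact lintegral_prod_add_mul_one_sub_indicator_le
          (fun k => measurableSet_activation R _ _) (iIndepSet_activation R hτinj a) hq A B _

end Growth

end SignedNetwork

theorem mainTheorem6 {Ω : Type*} [MeasurableSpace Ω] (P : Measure Ω) [IsProbabilityMeasure P]
    (n : ℕ) (hn : 3 ≤ n) (G : ℕ → SignedNetwork.SignedDigraph (Fin n))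
    (R : SignedNetwork.RandomEnvironment G P)
    (hA1 : SignedNetwork.SelectionLowerBound R)
    (hA4 : SignedNetwork.PosWindowConnected G)
    (hA5 : SignedNetwork.NegWindowConnected G)
    (hA6 : SignedNetwork.IndependentSelection R)
    (b d : ℝ) (hb : b ∈ Set.Ioo (0 : ℝ) 1) (hd : d ∈ Set.Ioo (0 : ℝ) 1)
    (hB : ∀ t, ∫ ω, R.B t ω ∂P = b) (hD : ∀ t, ∫ ω, R.D t ω ∂P = d)
    (α : ℝ) (hα : α ∈ Set.Icc (0 : ℝ) (2 * (n : ℝ))⁻¹) :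
    ∃ βstar : ℝ, 0 < βstar ∧ ∀ β : ℝ, βstar < β →
      ∀ᵐ s₀ : Fin n → ℝ ∂volume, ∀ᵐ ω ∂P,
        Tendsto (fun t : ℕ => ⨆ i, |SignedNetwork.state R α β s₀ ω t i|) atTop atTop := by
  have : Nontrivial (Fin n) := Fin.nontrivial_iff_two_le.2 (by omega)
  obtain ⟨p, hp, hpE⟩ := hA1
  obtain ⟨K, hK, hconn⟩ := hA5
  choose τ a hτ ha using fun k : ℕ =>
    SignedNetwork.exists_neg_arc_of_windowConnected (hconn (k * K))
  have hα' : α ∈ Set.Icc (0 : ℝ) (2 * (Fintype.card (Fin n) : ℝ))⁻¹ := by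
    rwa [Fintype.card_fin]
  obtain ⟨c, hc, hempty⟩ := SignedNetwork.exists_forall_le_abs_det hα'
  have hpd : 0 < p * d := mul_pos hp.1 hd.1
  have hcK : 0 < c ^ K := pow_pos hc.1 K
  obtain ⟨δ, hδ, H, hH, hlt⟩ := SignedNetwork.exists_rpow_neg_add_lt_one hcK hpd
  obtain ⟨β₀, hβ₀⟩ := eventually_atTop.1 (SignedNetwork.eventually_le_abs_det hα' H)
  -- The `1` serves only to make the threshold positive.
  refine ⟨max β₀ 1, by positivity, fun β hβ => ?_⟩
  have hq : ∀ k, ENNReal.ofReal (p * d) ≤ P (SignedNetwork.activation R (τ k) (a k)) := by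
    intro k
    rw [SignedNetwork.measure_activation, ENNReal.ofReal_mul hp.1.le]
    refine mul_le_mul' ?_ ?_
    · exact (ENNReal.ofReal_le_iff_le_toReal (measure_ne_top _ _)).2 (hpE _ _ _ (Or.inr (ha k)))
    · rw [← hD (τ k), ← SignedNetwork.measureReal_D_eq_one, ofReal_measureReal]
  have hρ : ENNReal.ofReal ((c ^ K * H) ^ (-δ)) + ENNReal.ofReal ((c ^ K) ^ (-δ)) *
      (1 - ENNReal.ofReal (p * d)) < 1 := by
    have hpd1 : p * d ≤ 1 := mul_le_one₀ hp.2.le hd.1.le hd.2.le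
    rw [← ENNReal.ofReal_one, ← ENNReal.ofReal_sub _ hpd.le,
      ← ENNReal.ofReal_mul (by positivity), ← ENNReal.ofReal_add (by positivity)
        (mul_nonneg (by positivity) (sub_nonneg.2 hpd1))]
    exact (ENNReal.ofReal_lt_ofReal_iff one_pos).2 hlt
  refine SignedNetwork.ae_ae_tendsto_of_tsum_ne_top R fun N => ?_
  refine ne_top_of_le_ne_top ?_ (ENNReal.tsum_le_tsum fun t =>
    SignedNetwork.measure_prod_le_pow_div R hc hH hδ hK hτ ha hq (hempty β)
      (hβ₀ β ((le_max_left _ _).trans hβ.le)) N t)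
  rw [ENNReal.tsum_mul_left]
  exact ENNReal.mul_ne_top (ENNReal.mul_ne_top measure_closedBall_lt_top.ne ENNReal.ofReal_ne_top)
    (SignedNetwork.tsum_pow_div_ne_top hρ hK)
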